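/- **Setting.** An instance consists of a metric $d$ on a set $X$ of $n$ points and a ranking $\pi_x$ of $X$ for every $x\in X$ such that $d(x,\pi_x(i))\le d(x,\pi_x(j))$ whenever $i<j$. For a nonempty $C\subseteq X$ let $\mathrm{cost}(C)=\sum_{x\in X}\min_{c\in C}d(x,c)$, and let $\mathrm{OPT}_k=\min_{1\le|C|\le k}\mathrm{cost}(C)$. A (randomized) algorithm receives the rankings for free, may adaptively query distances $d(x,y)$, each at unit cost, and returns a nonempty set $C\subseteq X$ of centers. Let $\log^* n$ denote the number of times $\log_2$ has to be applied to $n$ until the value is at most $1$. **Theorem.** Fix a distortion bound $\alpha\in\mathbb R$ and a success probability $\delta>0$. 1. For every fixed $k\ge 1$ there are $c>0$ and $n_0$, depending only on $\alpha,\delta,k$, such that for all $n\ge n_0$: if a randomized algorithm on $n$-point instances has, on every instance, probability at least $\delta$ of making no query and returning a set $C$ of at most $K$ centers with $\mathrm{cost}(C)\le\alpha\cdot\mathrm{OPT}_k$, then $K\ge c\,\bigl(2^{\log^* n}\bigr)^{k-1}$. That is, every purely ordinal bicriteria algorithm for $k$-median that has distortion at most $\alpha$ (in particular, less than $\alpha$)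 with constant probability must return $\Omega\bigl((2^{\log^* n})^{k-1}\bigr)$ centers. 2. There is $c>0$, depending only on $\alpha,\delta$, such that for every fixed $k\ge 2$ there is $n_0$ such that for all $n\ge n_0$: if a randomized algorithm on $n$-point instances has, on every instance, probability at least $\delta$ of making at most $q$ queries and returning a set $C$ of at most $k$ centers with $\mathrm{cost}(C)\le\alpha\cdot\mathrm{OPT}_k$, then $q\ge c\,k\,2^{\log^* n}$. That is, achieving constant distortion for $k$-median with constant probability requires $\Omega(k\cdot 2^{\log^* n})$ queries. -/

import Mathlib

open MeasureTheory

universe u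

namespace OrdinalClustering

/-! ### The iterated logarithm -/

/-- `log* x`: the least number of applications of `log₂` that brings `x` to a value at most `1`. -/
noncomputable def logStar (x : ℝ) : ℕ :=
  sInf {m : ℕ | (Real.logb 2)^[m] x ≤ 1}

/-- The iterated logarithm is well defined: the infimum is over a nonempty set. -/
theorem exists_iterate_logb_le_one (x : ℝ) : ∃ m : ℕ, (Real.logb 2)^[m] x ≤ 1 := by
  obtain ⟨N, hN⟩ := exists_nat_ge x
  induction N generalizing x with
  | zero => exact ⟨0, by simp at hN ⊢; linarith⟩
  | succ N ih =>
    by_cases h1 : x ≤ 1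
    · exact ⟨0, by simpa using h1⟩
    have hl : 0 < Real.log 2 := Real.log_pos (by norm_num)
    by_cases h2 : x ≤ 2
    · refine ⟨1, ?_⟩
      have h := Real.log_le_log (by linarith) h2
      simp only [Function.iterate_one, Real.logb]
      rw [div_le_one hl]
      exact h
    · have hx : Real.logb 2 x ≤ (N : ℝ) := by
        have h3 := Real.log_le_sub_one_of_pos (show 0 < x / 2 by linarith)
        rw [Real.log_div (by linarith) (by norm_num)] at h3
        have h4 := Real.log_two_gt_d9
        have h5 : Real.log x ≤ (x - 1) * Real.log 2 := by nlinarith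
        have h6 : Real.logb 2 x ≤ x - 1 := by
          rw [Real.logb, div_le_iff₀ hl]
          exact h5
        push_cast at hN
        linarith
      obtain ⟨m, hm⟩ := ih _ hx
      exact ⟨m + 1, by simpa [Function.iterate_succ_apply] using hm⟩

/-! ### Instances: `n` points with a metric and a consistent preference profile -/

/-- A preference profile: `P x i` is the `i`-th point in the ranking of the point `x`. -/
abbrev Profile (n : ℕ) : Type := Fin n → Equiv.Perm (Fin n)

/-- The ranking of every point is consistent with the metric `d`:
points that are ranked higher are not farther away. -/
def Consistent {n : ℕ} (P : Profile n) (d : MetricSpace (Fin n)) : Prop :=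
  ∀ x i j : Fin n, i < j → d.dist x (P x i) ≤ d.dist x (P x j)

/-! ### The `k`-median objective -/

/-- A solution: a nonempty set of centers. -/
abbrev Centers (n : ℕ) : Type := {C : Finset (Fin n) // C.Nonempty}

/-- The `k`-median cost `∑ x, min_{c ∈ C} d(x, c)`. -/
noncomputable def cost {n : ℕ} (d : MetricSpace (Fin n)) (C : Centers n) : ℝ :=
  ∑ x : Fin n, C.1.inf' C.2 (fun c => d.dist x c)

/-- The cost of an optimal solution with at most `k` centers. -/
noncomputable def optCost {n : ℕ} (d : MetricSpace (Fin n)) (k : ℕ) : ℝ :=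
  sInf {r : ℝ | ∃ C : Centers n, C.1.card ≤ k ∧ cost d C = r}

/-- For `1 ≤ k` and `1 ≤ n` the optimal cost is attained. -/
theorem exists_cost_eq_optCost {n k : ℕ} (hn : 1 ≤ n) (hk : 1 ≤ k) (d : MetricSpace (Fin n)) :
    ∃ C : Centers n, C.1.card ≤ k ∧ cost d C = optCost d k := by
  have hfin : {r : ℝ | ∃ C : Centers n, C.1.card ≤ k ∧ cost d C = r}.Finite := by
    refine (Set.finite_range (cost d)).subset ?_
    rintro r ⟨C, -, rfl⟩
    exact ⟨C, rfl⟩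
  have hne : {r : ℝ | ∃ C : Centers n, C.1.card ≤ k ∧ cost d C = r}.Nonempty :=
    ⟨_, ⟨{⟨0, hn⟩}, Finset.singleton_nonempty _⟩, by simpa using hk, rfl⟩
  exact hne.csInf_mem hfin

/-! ### Algorithms -/

/-- What a deterministic algorithm does once it knows the preference profile: it either answers
with a set of centers, or queries the distance of two points and continues depending on the
real number that it is told. -/
inductive QueryTree (n : ℕ) : Type
  | answer (C : Centers n) : QueryTree n
  | query (x y : Fin n) (next : ℝ → QueryTree n) : QueryTree n

/-- The set of centers returned when the distances are given by `d`. -/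
def QueryTree.output {n : ℕ} (d : MetricSpace (Fin n)) : QueryTree n → Centers n
  | .answer C => C
  | .query x y next => (next (d.dist x y)).output d

/-- The number of distance queries made when the distances are given by `d`. -/
def QueryTree.queries {n : ℕ} (d : MetricSpace (Fin n)) : QueryTree n → ℕ
  | .answer _ => 0
  | .query x y next => (next (d.dist x y)).queries d + 1

/-- A randomized algorithm for `n`-point instances: a random deterministic algorithm, which
receives the profile for free and accesses the metric by adaptive queries. On every instance, the
returned set and the number of queries are random variables. -/
structure RandomizedAlgorithm (n : ℕ) where
  Ω : Type u
  [measurableSpace : MeasurableSpace Ω]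
  μ : Measure Ω
  isProbabilityMeasure : IsProbabilityMeasure μ
  alg : Ω → Profile n → QueryTree n
  measurable_output : ∀ (P : Profile n) (d : MetricSpace (Fin n)), Consistent P d →
    ∀ C : Centers n, MeasurableSet {ω | (alg ω P).output d = C}
  measurable_queries : ∀ (P : Profile n) (d : MetricSpace (Fin n)), Consistent P d →
    ∀ q : ℕ, MeasurableSet {ω | (alg ω P).queries d = q}

/-- On every instance with `n` points, with probability at least `δ`, the algorithm makes at most
`q` queries and returns at most `K` centers whose cost is at most `α` times the cost of an optimal
solution with `k` centers. -/
def RandomizedAlgorithm.Achieves {n : ℕ} (A : RandomizedAlgorithm.{u} n)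
    (k : ℕ) (α δ : ℝ) (K q : ℕ) : Prop :=
  ∀ (P : Profile n) (d : MetricSpace (Fin n)), Consistent P d →
    ENNReal.ofReal δ ≤ A.μ {ω | (A.alg ω P).queries d ≤ q ∧
      ((A.alg ω P).output d).1.card ≤ K ∧
      cost d ((A.alg ω P).output d) ≤ α * optCost d k}

end OrdinalClustering

namespace OrdinalClustering

/-! ### Growth of the iterated logarithm -/

/-! One ranking profile fits a whole family of metrics. Points are grouped in levels of geometric
size, about `B ^ t` points in level `t`. In the `t`-th metric level `t` is a cluster of diameter at
most 1 at distance `n` from all else, and all higher levels together form another. Two centers then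
cost at most `2 * n * B ^ t`, while missing level `t` costs at least `(B - 1) * B ^ t * n`; for `B >
2α + 1` every good solution has a center in level `t` (`exists_mem_logLevel_eq`). Distances take two
values over the family, so `q` queries yield at most `2 ^ q` outputs
(`QueryTree.card_image_output_le`), which together hit at most `K * 2 ^ q` levels. Averaging over
the randomness gives `δ * T ≤ K * 2 ^ q` for about `log n` levels. Both claims follow because `2 ^
log* n` is negligible even against `log log n`. -/

theorem logStar_of_le_one {x : ℝ} (hx : x ≤ 1) : logStar x = 0 := by
  unfold logStar
  exact Nat.sInf_eq_zero.2 (Or.inl (by simpa using hx))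

theorem logStar_of_one_lt {x : ℝ} (hx : 1 < x) : logStar x = logStar (Real.logb 2 x) + 1 := by
  unfold logStar
  have h : 0 < sInf {m : ℕ | (Real.logb 2)^[m] x ≤ 1} := by
    refine Nat.pos_of_ne_zero fun h0 => ?_
    rcases Nat.sInf_eq_zero.1 h0 with h1 | h1
    · simp only [Set.mem_ofPred_eq, Function.iterate_zero, id] at h1
      linarith
    · obtain ⟨m, hm⟩ := exists_iterate_logb_le_one x
      exact (h1 ▸ hm : m ∈ (∅ : Set ℕ))
  have := Nat.sInf_add (n := 1) (p := fun m => (Real.logb 2)^[m] x ≤ 1) h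
  rw [← this]
  simp [Function.iterate_succ_apply]

theorem two_pow_logStar_le {x : ℝ} (hx : 1 ≤ x) : (2 : ℝ) ^ logStar x ≤ 2 * x := by
  obtain ⟨N, hN⟩ := exists_nat_ge x
  induction N generalizing x with
  | zero => norm_num at hN; linarith
  | succ N ih =>
    rcases hx.eq_or_lt with rfl | h1
    · rw [logStar_of_le_one le_rfl]; norm_num
    have hlog : Real.logb 2 x * Real.log 2 = Real.log x :=
      div_mul_cancel₀ _ (Real.log_pos (by norm_num)).ne'
    have hl2 := Real.log_two_gt_d9
    rw [logStar_of_one_lt h1, pow_succ]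
    rcases le_or_gt x 2 with h2 | h2
    · rw [logStar_of_le_one]
      · linarith
      · rw [Real.logb_le_iff_le_rpow (by norm_num) (by linarith)]; simpa using h2
    -- The halving `log₂ x ≤ x / 2`, which pays for the factor 2 of one more logarithm, fails
    -- strictly between 2 and 4.
    rcases le_or_gt x 4 with h4 | h4
    · have h5 : 1 < Real.logb 2 x := by
        rw [Real.lt_logb_iff_rpow_lt (by norm_num) (by linarith)]; simpa using h2
      have h6 : Real.logb 2 (Real.logb 2 x) ≤ 1 := by
        rw [Real.logb_le_iff_le_rpow (by norm_num) (by linarith), Real.rpow_one,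
          Real.logb_le_iff_le_rpow (by norm_num) (by linarith)]
        norm_num; exact h4
      rw [logStar_of_one_lt h5, logStar_of_le_one h6]
      norm_num; linarith
    · have h3 : Real.log (x / 4) ≤ x / 4 - 1 := Real.log_le_sub_one_of_pos (by linarith)
      have h44 : Real.log 4 = 2 * Real.log 2 := by
        rw [show (4 : ℝ) = 2 ^ 2 by norm_num, Real.log_pow]; norm_num
      rw [Real.log_div (by linarith) (by norm_num), h44] at h3
      have h7 : Real.logb 2 x ≤ x / 2 := by
        have : Real.logb 2 x * Real.log 2 ≤ x / 2 * Real.log 2 := by rw [hlog]; nlinarith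
        exact le_of_mul_le_mul_right this (by linarith)
      have h5 : 1 ≤ Real.logb 2 x := by
        rw [Real.le_logb_iff_rpow_le (by norm_num) (by linarith)]; simp; linarith
      have h8 : x / 2 ≤ N := by push_cast at hN; linarith
      have := ih h5 (h7.trans h8)
      linarith

theorem two_pow_logStar_isLittleO :
    (fun x : ℝ => (2 : ℝ) ^ logStar x) =o[Filter.atTop] (fun x : ℝ => x) := by
  refine Asymptotics.IsBigO.trans_isLittleO (g := Real.log) ?_ Real.isLittleO_log_id_atTop
  refine Asymptotics.IsBigO.of_bound (4 / Real.log 2) ?_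
  filter_upwards [Filter.eventually_ge_atTop 2] with x hx
  have h5 : 1 ≤ Real.logb 2 x := by
    rw [Real.le_logb_iff_rpow_le (by norm_num) (by linarith)]; simpa using hx
  have h := two_pow_logStar_le h5
  rw [logStar_of_one_lt (by linarith), pow_succ, Real.norm_of_nonneg (by positivity),
    Real.norm_of_nonneg (Real.log_nonneg (by linarith))]
  calc _ ≤ 2 * Real.logb 2 x * 2 := by linarith
    _ = _ := by rw [Real.logb]; ring

/-- Even an exponential of a multiple of `2 ^ log* n` is dominated by `log n`. -/
theorem eventually_two_rpow_le_log (A : ℝ) (hA : 0 < A) :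
    ∀ᶠ n : ℕ in Filter.atTop,
      A * (2 : ℝ) ^ (A * (2 : ℝ) ^ logStar (n : ℝ)) ≤ Real.logb 2 n := by
  have hlog : Filter.Tendsto (Real.logb 2) Filter.atTop Filter.atTop :=
    Real.tendsto_logb_atTop (by norm_num)
  -- Used at `y = log₂ log₂ n`, where `log* n = log* y + 2`; hence the factor 4.
  have h1 : ∀ᶠ y : ℝ in Filter.atTop, Real.logb 2 A + 4 * A * (2 : ℝ) ^ logStar y ≤ y := by
    have h2 := two_pow_logStar_isLittleO.bound (show 0 < 1 / (8 * A) by positivity)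
    filter_upwards [h2, Filter.eventually_ge_atTop (2 * Real.logb 2 A),
      Filter.eventually_ge_atTop 0] with y hy hy2 hy0
    rw [Real.norm_of_nonneg (by positivity), Real.norm_of_nonneg hy0] at hy
    have : 4 * A * (2 : ℝ) ^ logStar y ≤ 4 * A * (1 / (8 * A) * y) := by gcongr
    have h3 : 4 * A * (1 / (8 * A) * y) = y / 2 := by field_simp; ring
    linarith
  have hx : Filter.Tendsto (fun n : ℕ => Real.logb 2 (n : ℝ)) Filter.atTop Filter.atTop :=
    hlog.comp tendsto_natCast_atTop_atTop
  filter_upwards [(hlog.comp hx).eventually h1, hx.eventually_gt_atTop 1,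
    Filter.eventually_gt_atTop 1] with n hn hn1 hn2
  simp only [Function.comp] at hn
  rw [logStar_of_one_lt (by exact_mod_cast hn2), logStar_of_one_lt hn1, pow_succ, pow_succ]
  have h0 : 0 < Real.logb 2 (n : ℝ) := by linarith
  rw [← Real.rpow_logb (by norm_num : (0 : ℝ) < 2) (by norm_num) h0]
  nth_rewrite 1 [← Real.rpow_logb (by norm_num : (0 : ℝ) < 2) (by norm_num) hA]
  rw [← Real.rpow_add (by norm_num)]
  refine Real.rpow_le_rpow_of_exponent_le (by norm_num) ?_
  rw [Real.rpow_logb (by norm_num : (0 : ℝ) < 2) (by norm_num) h0]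
  linarith

/-! ### Ultrametrics on the points, graded by levels -/

/-- An integer-valued ultrametric: points of the same level are closest, and two points of
different levels are the farther apart the smaller the lower one of their levels is. -/
def levelKey {n : ℕ} (lev : Fin n → ℕ) (x y : Fin n) : ℕ :=
  if x = y then 0 else if lev x = lev y then 1 else 2 + (n - min (lev x) (lev y))

theorem levelKey_comm {n : ℕ} (lev : Fin n → ℕ) (x y : Fin n) :
    levelKey lev x y = levelKey lev y x := by
  simp only [levelKey, eq_comm (a := x), eq_comm (a := lev x), min_comm (lev x)]

theorem levelKey_eq_zero {n : ℕ} {lev : Fin n → ℕ} {x y : Fin n} :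
    levelKey lev x y = 0 ↔ x = y := by
  unfold levelKey
  split_ifs <;> simp_all

/-- For distinct levels the key decreases in the lower level, and a detour through `y` cannot raise
the lowest level met. -/
theorem levelKey_le_max {n : ℕ} (lev : Fin n → ℕ) (x y z : Fin n) :
    levelKey lev x z ≤ max (levelKey lev x y) (levelKey lev y z) := by
  unfold levelKey
  by_cases h1 : x = y
  · subst h1; simp
  by_cases h2 : y = z
  · subst h2; simp
  split_ifs <;> grind

/-- The monotone function of the key with the values `0`, `1` and `n`; the value is `n` for points
of different levels of which one is at most `t`. -/
noncomputable def thresholdDist (n t m : ℕ) : ℝ :=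
  if m = 0 then 0 else if m < 2 + (n - t) then 1 else n

theorem thresholdDist_mono {n : ℕ} (hn : 1 ≤ n) (t : ℕ) :
    Monotone (thresholdDist n t) := by
  intro a b hab
  have : (1 : ℝ) ≤ n := by exact_mod_cast hn
  unfold thresholdDist
  split_ifs <;> first | linarith | omega

/-- The metric space with the distances `thresholdDist`. -/
@[reducible] noncomputable def thresholdMetric {n : ℕ} (lev : Fin n → ℕ) (t : ℕ) :
    MetricSpace (Fin n) where
  dist x y := thresholdDist n t (levelKey lev x y)
  dist_self x := by simp [levelKey, thresholdDist]
  dist_comm x y := by rw [levelKey_comm]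
  dist_triangle x y z := by
    have hn : 1 ≤ n := Nat.one_le_iff_ne_zero.2 (by rintro rfl; exact x.elim0)
    have hm := thresholdDist_mono hn t
    have h0 : ∀ m, 0 ≤ thresholdDist n t m := fun m => by
      simpa [thresholdDist] using hm (Nat.zero_le m)
    refine (hm (levelKey_le_max lev x y z)).trans ?_
    rw [hm.map_max]
    exact max_le_add_of_nonneg (h0 _) (h0 _)
  eq_of_dist_eq_zero := by
    intro x y h
    have hn : n ≠ 0 := by rintro rfl; exact x.elim0
    by_contra hxy
    have h1 : levelKey lev x y ≠ 0 := fun h2 => hxy (levelKey_eq_zero.1 h2)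
    change thresholdDist n t (levelKey lev x y) = 0 at h
    unfold thresholdDist at h
    split_ifs at h <;> simp_all

theorem thresholdMetric_dist {n : ℕ} (lev : Fin n → ℕ) (t : ℕ) (x y : Fin n) :
    (thresholdMetric lev t).dist x y = thresholdDist n t (levelKey lev x y) := rfl

/-- The ranking of the points by `levelKey`. -/
def levelProfile {n : ℕ} (lev : Fin n → ℕ) : Profile n := fun x => Tuple.sort (levelKey lev x)

/-- Every threshold metric is a monotone function of the key that the profile sorts by, so the
rankings reveal nothing about `t`. -/
theorem consistent_levelProfile {n : ℕ} (lev : Fin n → ℕ) (t : ℕ) :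
    Consistent (levelProfile lev) (thresholdMetric lev t) := by
  intro x i j hij
  have hn : 1 ≤ n := Nat.one_le_iff_ne_zero.2 (by rintro rfl; exact x.elim0)
  exact thresholdDist_mono hn t (Tuple.monotone_sort (levelKey lev x) hij.le)

theorem thresholdMetric_dist_le {n : ℕ} (lev : Fin n → ℕ) (t : ℕ) (x y : Fin n) :
    (thresholdMetric lev t).dist x y ≤ n := by
  have hn : (1 : ℝ) ≤ n := by
    exact_mod_cast Nat.one_le_iff_ne_zero.2 (by rintro rfl; exact x.elim0)
  rw [thresholdMetric_dist]
  unfold thresholdDist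
  split_ifs <;> linarith

/-- `htn` keeps the truncated `n - t` positive, so levels above `t` have keys strictly below the
cutoff. -/
theorem thresholdMetric_dist_le_one {n : ℕ} {lev : Fin n → ℕ} {t : ℕ} {x y : Fin n}
    (htn : t < n) (h : lev x = lev y ∨ t < lev x ∧ t < lev y) :
    (thresholdMetric lev t).dist x y ≤ 1 := by
  rw [thresholdMetric_dist]
  have : levelKey lev x y < 2 + (n - t) := by
    unfold levelKey; split_ifs <;> omega
  unfold thresholdDist
  split_ifs <;> norm_num

theorem thresholdMetric_dist_eq {n : ℕ} {lev : Fin n → ℕ} {t : ℕ} {x y : Fin n}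
    (hx : lev x = t) (hy : lev y ≠ t) :
    (thresholdMetric lev t).dist x y = n := by
  rw [thresholdMetric_dist]
  have : 2 + (n - t) ≤ levelKey lev x y := by
    have hxy : x ≠ y := by rintro rfl; exact hy hx
    unfold levelKey; split_ifs <;> omega
  unfold thresholdDist
  split_ifs <;> first | rfl | omega

/-- Each distance has only two possible values over all thresholds. -/
theorem thresholdMetric_dist_two_values {n : ℕ} (lev : Fin n → ℕ) (x y : Fin n) :
    ∃ a b : ℝ, ∀ t : ℕ, (thresholdMetric lev t).dist x y = a ∨
      (thresholdMetric lev t).dist x y = b := by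
  by_cases h : levelKey lev x y = 0
  · exact ⟨0, 0, fun t => Or.inl (by simp [thresholdMetric_dist, thresholdDist, h])⟩
  · refine ⟨1, n, fun t => ?_⟩
    simp only [thresholdMetric_dist, thresholdDist, if_neg h]
    split_ifs <;> simp

/-! ### Query trees see few of the metrics apart -/

/-- On this family each query has at most two answers, so the part of the tree reached from `S` is
binary of depth at most `q`. -/
theorem QueryTree.card_image_output_le {n : ℕ} {ι : Type*} (d : ι → MetricSpace (Fin n))
    (hd : ∀ x y, ∃ a b : ℝ, ∀ i, (d i).dist x y = a ∨ (d i).dist x y = b)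
    (t : QueryTree n) (q : ℕ) (S : Finset ι) (hS : ∀ i ∈ S, t.queries (d i) ≤ q) :
    (S.image fun i => t.output (d i)).card ≤ 2 ^ q := by
  classical
  induction t generalizing q S with
  | answer C =>
    refine (Finset.card_le_card (t := {C}) ?_).trans ?_
    · intro D hD
      obtain ⟨i, -, rfl⟩ := Finset.mem_image.1 hD
      simp [QueryTree.output]
    · simpa using Nat.one_le_two_pow
  | query x y next ih =>
    rcases S.eq_empty_or_nonempty with rfl | ⟨i₀, hi₀⟩
    · simp
    obtain ⟨a, b, hab⟩ := hd x y
    obtain ⟨q, rfl⟩ : ∃ p, q = p + 1 := by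
      have := hS i₀ hi₀
      simp only [QueryTree.queries] at this
      exact ⟨q - 1, by omega⟩
    have key : ∀ r : ℝ, ((S.filter fun i => (d i).dist x y = r).image
        fun i => (next r).output (d i)).card ≤ 2 ^ q := by
      refine fun r => ih r q _ fun i hi => ?_
      obtain ⟨hiS, hir⟩ := Finset.mem_filter.1 hi
      have := hS i hiS
      simp only [QueryTree.queries, hir] at this
      omega
    refine (Finset.card_le_card (t := ((S.filter fun i => (d i).dist x y = a).image
      fun i => (next a).output (d i)) ∪ ((S.filter fun i => (d i).dist x y = b).image
      fun i => (next b).output (d i))) ?_).trans ?_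
    · intro D hD
      obtain ⟨i, hi, rfl⟩ := Finset.mem_image.1 hD
      simp only [QueryTree.output, Finset.mem_union, Finset.mem_image, Finset.mem_filter]
      rcases hab i with h | h
      · exact Or.inl ⟨i, ⟨hi, h⟩, by rw [h]⟩
      · exact Or.inr ⟨i, ⟨hi, h⟩, by rw [h]⟩
    · refine (Finset.card_union_le _ _).trans ?_
      have := key a
      have := key b
      rw [pow_succ]
      omega

/-! ### Costs -/

theorem cost_nonneg {n : ℕ} (d : MetricSpace (Fin n)) (C : Centers n) : 0 ≤ cost d C :=
  Finset.sum_nonneg fun x _ => Finset.le_inf' _ _ fun c _ => @dist_nonneg _ d.toPseudoMetricSpace x c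

theorem optCost_le {n k : ℕ} (d : MetricSpace (Fin n)) (C : Centers n) (hC : C.1.card ≤ k) :
    optCost d k ≤ cost d C :=
  csInf_le ⟨0, by rintro r ⟨D, -, rfl⟩; exact cost_nonneg d D⟩ ⟨C, hC, rfl⟩

theorem optCost_nonneg {n : ℕ} (d : MetricSpace (Fin n)) (k : ℕ) : 0 ≤ optCost d k :=
  Real.sInf_nonneg (by rintro r ⟨D, -, rfl⟩; exact cost_nonneg d D)

/-! ### The hard family: levels of geometric size -/

/-- The level of a point: its number of digits in base `B`, minus one. -/
def logLevel (B n : ℕ) (x : Fin n) : ℕ := Nat.log B x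

/-- One center in level `t` and one in level `t + 1`, which serves everything above `t`, leave only
points below `B ^ t` at distance more than 1. -/
theorem optCost_logLevel_le {B n k t : ℕ} (hB : 2 ≤ B) (hk : 2 ≤ k) (ht : B ^ (t + 1) < n) :
    optCost (thresholdMetric (logLevel B n) t) k ≤ 2 * n * B ^ t := by
  have hBt : B ^ t < n := (Nat.pow_lt_pow_right hB (Nat.lt_succ_self t)).trans ht
  have htn : t < n := (Nat.lt_pow_self hB).trans hBt
  let a : Fin n := ⟨B ^ t, hBt⟩
  let b : Fin n := ⟨B ^ (t + 1), ht⟩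
  have ha : logLevel B n a = t := Nat.log_pow hB t
  have hb : logLevel B n b = t + 1 := Nat.log_pow hB (t + 1)
  refine (optCost_le _ ⟨{a, b}, by simp⟩ (Finset.card_le_two.trans hk)).trans ?_
  have hx : ∀ x : Fin n, ({a, b} : Finset (Fin n)).inf' (by simp)
      (fun c => (thresholdMetric (logLevel B n) t).dist x c) ≤
        1 + if (x : ℕ) < B ^ t then (n : ℝ) else 0 := by
    intro x
    rcases lt_trichotomy (logLevel B n x) t with h | h | h
    · have : (x : ℕ) < B ^ t := Nat.lt_pow_of_log_lt hB h
      rw [if_pos this]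
      refine (Finset.inf'_le _ (show a ∈ _ by simp)).trans ?_
      linarith [thresholdMetric_dist_le (logLevel B n) t x a]
    · have h1 := (Finset.inf'_le _ (show a ∈ ({a, b} : Finset (Fin n)) by simp)).trans
        (thresholdMetric_dist_le_one (lev := logLevel B n) (t := t) (x := x) htn
          (Or.inl (h.trans ha.symm)))
      refine h1.trans ?_
      split_ifs <;> simp
    · have h1 := (Finset.inf'_le _ (show b ∈ ({a, b} : Finset (Fin n)) by simp)).trans
        (thresholdMetric_dist_le_one (lev := logLevel B n) (t := t) (x := x) htn
          (Or.inr ⟨h, hb.symm ▸ Nat.lt_succ_self t⟩))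
      refine h1.trans ?_
      split_ifs <;> simp
  refine (Finset.sum_le_sum fun x _ => hx x).trans ?_
  have hcard : (Finset.univ.filter fun x : Fin n => (x : ℕ) < B ^ t).card ≤ B ^ t := by
    rw [Fin.card_filter_val_lt]; exact min_le_right _ _
  have hcard' : ((Finset.univ.filter fun x : Fin n => (x : ℕ) < B ^ t).card : ℝ) ≤ B ^ t := by
    exact_mod_cast hcard
  have h1 : (1 : ℝ) ≤ B ^ t := by exact_mod_cast Nat.one_le_pow _ _ (by omega)
  have hn0 : (0 : ℝ) ≤ n := Nat.cast_nonneg n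
  rw [Finset.sum_add_distrib, ← Finset.sum_filter]
  simp only [Finset.sum_const, Finset.card_univ, Fintype.card_fin, nsmul_eq_mul, mul_one]
  nlinarith

theorem le_cost_logLevel {B n t : ℕ} (hB : 2 ≤ B) (ht : B ^ (t + 1) < n) (C : Centers n)
    (hC : ∀ c ∈ C.1, logLevel B n c ≠ t) :
    ((B : ℝ) - 1) * B ^ t * n ≤ cost (thresholdMetric (logLevel B n) t) C := by
  classical
  let d := thresholdMetric (logLevel B n) t
  let S : Finset (Fin n) := Finset.univ.filter fun x : Fin n => logLevel B n x = t
  have hS : (B - 1) * B ^ t ≤ S.card := by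
    -- Only an inclusion: `Nat.log B 0 = 0` puts the point 0 in level 0 as well.
    have h1 : ((Finset.Ico (B ^ t) (B ^ (t + 1))).attachFin
        (fun m hm => (Finset.mem_Ico.1 hm).2.trans ht)) ⊆ S := by
      intro x hx
      rw [Finset.mem_attachFin, Finset.mem_Ico] at hx
      exact Finset.mem_filter.2 ⟨Finset.mem_univ x, Nat.log_eq_of_pow_le_of_lt_pow hx.1 hx.2⟩
    have h2 := Finset.card_le_card h1
    rw [Finset.card_attachFin, Nat.card_Ico] at h2
    rwa [Nat.sub_mul, one_mul, mul_comm B, ← pow_succ]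
  have hS' : ((B : ℝ) - 1) * B ^ t ≤ S.card := by
    have : (((B - 1) * B ^ t : ℕ) : ℝ) ≤ S.card := by exact_mod_cast hS
    rwa [Nat.cast_mul, Nat.cast_pow, Nat.cast_sub (by omega), Nat.cast_one] at this
  calc ((B : ℝ) - 1) * B ^ t * n ≤ S.card * n := by gcongr
    _ = ∑ x ∈ S, (n : ℝ) := by simp
    _ ≤ ∑ x ∈ S, C.1.inf' C.2 (fun c => d.dist x c) := by
        refine Finset.sum_le_sum fun x hx => Finset.le_inf' _ _ fun c hc => ?_
        exact (thresholdMetric_dist_eq (Finset.mem_filter.1 hx).2 (hC c hc)).ge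
    _ ≤ cost d C := by
        refine Finset.sum_le_sum_of_subset_of_nonneg (Finset.subset_univ S) fun x _ _ => ?_
        exact Finset.le_inf' _ _ fun c _ => @dist_nonneg _ d.toPseudoMetricSpace x c

/-- A solution of bounded distortion has a center of level `t`. -/
theorem exists_mem_logLevel_eq {B n k t : ℕ} {α : ℝ} (hB : 2 ≤ B) (hα : 2 * α + 1 < B)
    (hk : 2 ≤ k) (ht : B ^ (t + 1) < n) (C : Centers n)
    (hC : cost (thresholdMetric (logLevel B n) t) C ≤
      α * optCost (thresholdMetric (logLevel B n) t) k) :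
    ∃ c ∈ C.1, logLevel B n c = t := by
  by_contra! h
  have h1 := le_cost_logLevel hB ht C h
  have h2 := optCost_logLevel_le hB hk ht
  have h0 := optCost_nonneg (thresholdMetric (logLevel B n) t) k
  have hpos : (0 : ℝ) < n * B ^ t := by
    have : 0 < n := by omega
    positivity
  -- For negative `α` the allowed cost is at most 0, below the positive lower bound.
  rcases le_or_gt 0 α with h3 | h3
  · have := mul_le_mul_of_nonneg_left h2 h3
    nlinarith
  · have hB' : (2 : ℝ) ≤ B := by exact_mod_cast hB
    nlinarith [mul_nonneg (neg_nonneg.2 h3.le) h0]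

/-! ### The trade-off between queries and centers -/

/-- The sum is the expected number of events that occur. -/
theorem sum_measure_le_of_card_le {Ω ι : Type*} [MeasurableSpace Ω] (μ : Measure Ω)
    [IsProbabilityMeasure μ] (I : Finset ι) (S : ι → Set Ω) (hS : ∀ i, MeasurableSet (S i))
    (N : ℕ) (hN : ∀ ω, ∀ J ⊆ I, (∀ i ∈ J, ω ∈ S i) → J.card ≤ N) :
    ∑ i ∈ I, μ (S i) ≤ N := by
  classical
  calc ∑ i ∈ I, μ (S i) = ∑ i ∈ I, ∫⁻ ω, (S i).indicator 1 ω ∂μ := by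
        simp only [lintegral_indicator_one (hS _)]
    _ = ∫⁻ ω, ∑ i ∈ I, (S i).indicator 1 ω ∂μ :=
        (lintegral_finsetSum _ fun i _ => measurable_one.indicator (hS i)).symm
    _ ≤ ∫⁻ _, (N : ENNReal) ∂μ := by
        refine lintegral_mono fun ω => ?_
        have h := hN ω (I.filter fun i => ω ∈ S i) (Finset.filter_subset _ _)
          fun i hi => (Finset.mem_filter.1 hi).2
        simp only [Set.indicator_apply, Pi.one_apply, Finset.sum_boole]
        exact_mod_cast h
    _ = N := by simp

theorem RandomizedAlgorithm.measurableSet_success {n : ℕ} (A : RandomizedAlgorithm.{u} n)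
    (P : Profile n) (d : MetricSpace (Fin n)) (hP : Consistent P d) (q : ℕ)
    (p : Centers n → Prop) :
    @MeasurableSet A.Ω A.measurableSpace
      {ω | (A.alg ω P).queries d ≤ q ∧ p ((A.alg ω P).output d)} := by
  let := A.measurableSpace
  have h1 : {ω | (A.alg ω P).queries d ≤ q ∧ p ((A.alg ω P).output d)} =
      (⋃ r ∈ Set.Iic q, {ω | (A.alg ω P).queries d = r}) ∩
        ⋃ C ∈ {C | p C}, {ω | (A.alg ω P).output d = C} := by
    ext ω
    simp
  rw [h1]
  exact (MeasurableSet.biUnion (Set.to_countable _) fun r _ => A.measurable_queries P d hP r).inter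
    (MeasurableSet.biUnion (Set.to_countable _) fun C _ => A.measurable_output P d hP C)

/-- For fixed `ω`, each threshold where the run succeeds is a level hit by one of at most `2 ^ q`
outputs, each hitting at most `K` levels. -/
theorem RandomizedAlgorithm.Achieves.mul_le {n : ℕ} {A : RandomizedAlgorithm.{u} n}
    {k K q : ℕ} {α δ : ℝ} (hA : A.Achieves k α δ K q) (hk : 2 ≤ k) {B T : ℕ} (hB : 2 ≤ B)
    (hα : 2 * α + 1 < B) (hT : B ^ T < n) :
    δ * T ≤ (K : ℝ) * 2 ^ q := by
  classical
  let := A.measurableSpace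
  have := A.isProbabilityMeasure
  let lev := logLevel B n
  let P := levelProfile lev
  let S : ℕ → Set A.Ω := fun t => {ω | (A.alg ω P).queries (thresholdMetric lev t) ≤ q ∧
      ((A.alg ω P).output (thresholdMetric lev t)).1.card ≤ K ∧
      cost (thresholdMetric lev t) ((A.alg ω P).output (thresholdMetric lev t)) ≤
        α * optCost (thresholdMetric lev t) k}
  have hS : ∀ t, MeasurableSet (S t) := fun t =>
    A.measurableSet_success P _ (consistent_levelProfile lev t) q fun C => C.1.card ≤ K ∧
      cost (thresholdMetric lev t) C ≤ α * optCost (thresholdMetric lev t) k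
  have hcard : ∀ ω, ∀ J ⊆ Finset.range T, (∀ t ∈ J, ω ∈ S t) → J.card ≤ 2 ^ q * K := by
    intro ω J hJ hω
    let O := J.image fun t => (A.alg ω P).output (thresholdMetric lev t)
    have hO : O.card ≤ 2 ^ q := QueryTree.card_image_output_le (thresholdMetric lev)
      (thresholdMetric_dist_two_values lev) _ q J fun t ht => (hω t ht).1
    have hsub : J ⊆ O.biUnion fun C => C.1.image lev := by
      intro t ht
      have htT : B ^ (t + 1) < n := (Nat.pow_le_pow_right (by omega)
        (Finset.mem_range.1 (hJ ht))).trans_lt hT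
      obtain ⟨c, hc, hct⟩ := exists_mem_logLevel_eq hB hα hk htT _ (hω t ht).2.2
      exact Finset.mem_biUnion.2 ⟨_, Finset.mem_image_of_mem _ ht,
        Finset.mem_image.2 ⟨c, hc, hct⟩⟩
    refine (Finset.card_le_card hsub).trans ((Finset.card_biUnion_le_card_mul _ _ K ?_).trans
      (Nat.mul_le_mul_right K hO))
    intro C hC
    obtain ⟨t, ht, rfl⟩ := Finset.mem_image.1 hC
    exact Finset.card_image_le.trans (hω t ht).2.1
  have h1 := sum_measure_le_of_card_le A.μ (Finset.range T) S hS _ hcard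
  have h2 : ∑ _t ∈ Finset.range T, ENNReal.ofReal δ ≤ ((2 ^ q * K : ℕ) : ENNReal) :=
    (Finset.sum_le_sum fun t _ => hA P _ (consistent_levelProfile lev t)).trans h1
  rw [Finset.sum_const, Finset.card_range, nsmul_eq_mul] at h2
  have h3 : ENNReal.ofReal (T * δ) ≤ ENNReal.ofReal ((2 ^ q * K : ℕ) : ℝ) := by
    rwa [ENNReal.ofReal_mul (Nat.cast_nonneg T), ENNReal.ofReal_natCast, ENNReal.ofReal_natCast]
  have h4 := (ENNReal.ofReal_le_ofReal_iff (Nat.cast_nonneg _)).1 h3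
  push_cast at h4
  linarith

theorem RandomizedAlgorithm.Achieves.one_le {n : ℕ} {A : RandomizedAlgorithm.{u} n}
    {k K q : ℕ} {α δ : ℝ} (hA : A.Achieves k α δ K q) (hδ : 0 < δ) : 1 ≤ K := by
  let := A.measurableSpace
  have h := (ENNReal.ofReal_pos.2 hδ).trans_le
    (hA (levelProfile 0) (thresholdMetric 0 0) (consistent_levelProfile 0 0))
  obtain ⟨ω, -, hω, -⟩ := nonempty_of_measure_ne_zero h.ne'
  exact (Finset.card_pos.2 ((A.alg ω _).output _).2).trans_le hω

/-- Asymptotic form of the trade-off, with a bound that does not depend on the algorithm. -/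
theorem eventually_logb_le_of_achieves (α δ : ℝ) (hδ : 0 < δ) :
    ∃ c : ℝ, 0 < c ∧ ∃ n₀ : ℕ, ∀ n : ℕ, n₀ ≤ n →
      ∀ (A : RandomizedAlgorithm.{u} n) (k K q : ℕ), 2 ≤ k → A.Achieves k α δ K q →
        c * Real.logb 2 n ≤ (K : ℝ) * 2 ^ q := by
  obtain ⟨B₀, hB₀⟩ := exists_nat_gt (2 * α + 1)
  let B := B₀ + 2
  have hB : 2 ≤ B := by omega
  have hα : 2 * α + 1 < B := by push_cast [B]; linarith
  have hlB : 0 < Real.logb 2 B := Real.logb_pos (by norm_num) (by exact_mod_cast hB)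
  -- With `T = Nat.log B n - 1`, `B ^ T < n` is strict and `log₂ n ≤ (T + 2) * log₂ B ≤ 4 * T * log₂
  -- B`.
  refine ⟨δ / (4 * Real.logb 2 B), by positivity, B ^ 4, fun n hn A k K q hk hA => ?_⟩
  have hn0 : n ≠ 0 := by
    have : 0 < B ^ 4 := by positivity
    omega
  have hL : 4 ≤ Nat.log B n := by
    rw [← Nat.log_pow hB 4]
    exact Nat.log_mono_right hn
  have hT : B ^ (Nat.log B n - 1) < n :=
    (Nat.pow_lt_pow_right hB (by omega)).trans_le (Nat.pow_log_le_self B hn0)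
  have h1 := hA.mul_le hk hB hα hT
  have h2 : Real.logb 2 n ≤ (Nat.log B n + 1 : ℕ) * Real.logb 2 B := by
    rw [← Real.logb_pow]
    refine Real.logb_le_logb_of_le (by norm_num) (by positivity) ?_
    exact_mod_cast (Nat.lt_pow_succ_log_self hB n).le
  have h3 : ((Nat.log B n + 1 : ℕ) : ℝ) ≤ 4 * ((Nat.log B n - 1 : ℕ) : ℝ) := by
    exact_mod_cast (by omega : Nat.log B n + 1 ≤ 4 * (Nat.log B n - 1))
  refine le_trans ?_ h1
  rw [div_mul_eq_mul_div, div_le_iff₀ (by positivity), mul_assoc]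
  refine mul_le_mul_of_nonneg_left ?_ hδ.le
  calc _ ≤ _ := h2
    _ ≤ 4 * ((Nat.log B n - 1 : ℕ) : ℝ) * Real.logb 2 B := by gcongr
    _ = _ := by ring

end OrdinalClustering

/-! ### Both bounds from the logarithmic trade-off -/

theorem mainTheorem7 (α δ : ℝ) (hδ : 0 < δ) :
    (∀ k : ℕ, 1 ≤ k → ∃ c : ℝ, 0 < c ∧ ∃ n₀ : ℕ, ∀ n : ℕ, n₀ ≤ n →
      ∀ (A : OrdinalClustering.RandomizedAlgorithm.{u} n) (K : ℕ), A.Achieves k α δ K 0 →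
        c * ((2 : ℝ) ^ OrdinalClustering.logStar (n : ℝ)) ^ (k - 1) ≤ (K : ℝ)) ∧
    (∃ c : ℝ, 0 < c ∧ ∀ k : ℕ, 2 ≤ k → ∃ n₀ : ℕ, ∀ n : ℕ, n₀ ≤ n →
      ∀ (A : OrdinalClustering.RandomizedAlgorithm.{u} n) (q : ℕ), A.Achieves k α δ k q →
        c * ((k : ℝ) * (2 : ℝ) ^ OrdinalClustering.logStar (n : ℝ)) ≤ (q : ℝ)) := by
  obtain ⟨c, hc, n₁, hn₁⟩ := OrdinalClustering.eventually_logb_le_of_achieves.{u} α δ hδ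
  constructor
  · intro k hk
    rcases hk.eq_or_lt with rfl | hk
    · refine ⟨1, one_pos, 0, fun n _ A K hA => ?_⟩
      simpa using hA.one_le hδ
    have hk0 : (1 : ℝ) ≤ k := by exact_mod_cast hk.le
    obtain ⟨n₂, hn₂⟩ := Filter.eventually_atTop.1
      (OrdinalClustering.eventually_two_rpow_le_log k (by linarith))
    refine ⟨c, hc, max n₁ n₂, fun n hn A K hA => ?_⟩
    have h1 := hn₁ n ((le_max_left _ _).trans hn) A k K 0 hk hA
    have h2 := hn₂ n ((le_max_right _ _).trans hn)
    rw [pow_zero, mul_one] at h1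
    refine le_trans (mul_le_mul_of_nonneg_left (le_trans ?_ h2) hc.le) h1
    -- With `s = log* n`, the exponent `s * (k - 1)` is at most `k * 2 ^ s`.
    have h3 : ((2 : ℝ) ^ OrdinalClustering.logStar (n : ℝ)) ^ (k - 1) ≤
        (2 : ℝ) ^ ((k : ℝ) * (2 : ℝ) ^ OrdinalClustering.logStar (n : ℝ)) := by
      rw [← pow_mul, ← Real.rpow_natCast]
      refine Real.rpow_le_rpow_of_exponent_le (by norm_num) ?_
      have h4 : (OrdinalClustering.logStar (n : ℝ) : ℝ) ≤
          (2 : ℝ) ^ OrdinalClustering.logStar (n : ℝ) := by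
        exact_mod_cast (Nat.lt_two_pow_self).le
      have h5 : ((k - 1 : ℕ) : ℝ) ≤ k := by exact_mod_cast Nat.sub_le k 1
      rw [Nat.cast_mul, mul_comm]
      gcongr
    exact h3.trans (le_mul_of_one_le_left (by positivity) hk0)
  -- Any constant would do: `n₀` may depend on `k`, and `q` grows at least like `log log n`.
  · refine ⟨1, one_pos, fun k hk => ?_⟩
    have hk0 : (0 : ℝ) < k := by exact_mod_cast (by omega : 0 < k)
    -- `a ≥ k` bounds the assumed small `q` by the exponent, and `c * a > k` contradicts `c * a * 2
    -- ^ q ≤ k * 2 ^ q`.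
    let a : ℝ := k + (k + 1) / c
    have ha : (0 : ℝ) < a := by positivity
    obtain ⟨n₂, hn₂⟩ := Filter.eventually_atTop.1
      (OrdinalClustering.eventually_two_rpow_le_log a ha)
    refine ⟨max n₁ n₂, fun n hn A q hA => ?_⟩
    have h1 := hn₁ n ((le_max_left _ _).trans hn) A k k q hk hA
    have h2 := hn₂ n ((le_max_right _ _).trans hn)
    by_contra! hlt
    rw [one_mul] at hlt
    have h3 : (2 : ℝ) ^ q ≤ (2 : ℝ) ^ (a * (2 : ℝ) ^ OrdinalClustering.logStar (n : ℝ)) := by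
      rw [← Real.rpow_natCast]
      refine Real.rpow_le_rpow_of_exponent_le (by norm_num) (hlt.le.trans ?_)
      gcongr
      exact le_add_of_nonneg_right (by positivity)
    have hq : (0 : ℝ) < 2 ^ q := by positivity
    have h4 : c * (a * 2 ^ q) ≤ k * 2 ^ q := by
      refine le_trans (mul_le_mul_of_nonneg_left (le_trans ?_ h2) hc.le) h1
      gcongr
    have h5 : c * a = c * k + (k + 1) := by simp only [a]; field_simp
    rw [← mul_assoc, h5] at h4
    have := le_of_mul_le_mul_right h4 hq
    nlinarith [mul_pos hc hk0]
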